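/- Let $D\ge 0$, let $E:\mathbb{R}^D\to\mathbb{R}$ be smooth ($C^\infty$), with gradient $\nabla E$ and Hessian $\nabla^2E$. The full-order modified flow that backward error analysis (BEA) gives for gradient descent $\theta_0\mapsto\theta_0-h\nabla E(\theta_0)$ is the formal power series $\dot\theta=\sum_{p\ge 0}h^pf_p(\theta)$ in the learning rate $h$, where the $f_p:\mathbb{R}^D\to\mathbb{R}^D$ are smooth, do not depend on $h$, and are such that for every $n\ge 0$ and every $\theta_0$ there are $C$ and $h_0>0$ such that, for $0<h<h_0$, the flow $\dot\theta=\sum_{p=0}^{n}h^pf_p(\theta)$ has a solution on $[0,h]$ with $\theta(0)=\theta_0$ and $$\|\theta(h)-(\theta_0-h\nabla E(\theta_0))\|\le C\,h^{n+2}.$$ Write $\mathcal{C}(\nabla^3E)$ for a formal power series $\sum_p h^p\,c_p$ whose coefficients $c_p$ are vector-valued polynomials in the partial derivatives of $E$ of order $\ge 1$, each monomial of which contains at least one partial derivative of order at least three; these polynomials depend only on $D$ and $p$, not on $E$ or $\theta$. Then for every smooth $E$ the sequence $(f_p)_{p\ge0}$ exists and is unique, and as formal power series in $h$, at every $\theta\in\mathbb{R}^D$,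 $$\sum_{p=0}^{\infty}h^pf_p=\sum_{p=0}^{\infty}\frac{-1}{p+1}h^p(\nabla^2E)^p\nabla E+\mathcal{C}(\nabla^3E).$$ Moreover $\nabla^2E(\theta)$ has an orthonormal basis of eigenvectors (which may be ordered by decreasing eigenvalue), and for every orthonormal basis $u_0,\dots,u_{D-1}$ of eigenvectors of $\nabla^2E(\theta)$, with eigenvalues $\lambda_0,\dots,\lambda_{D-1}$, this series equals $$\sum_{p=0}^{\infty}\frac{-1}{p+1}h^p\Big(\sum_{i=0}^{D-1}\lambda_i^p\,u_iu_i^T\Big)\nabla E+\mathcal{C}(\nabla^3E)=\sum_{i=0}^{D-1}\Big(\sum_{p=0}^{\infty}\frac{-1}{p+1}h^p\lambda_i^p\Big)(\nabla E^Tu_i)\,u_i+\mathcal{C}(\nabla^3E),$$ with the same $\mathcal{C}(\nabla^3E)$ in all three expressions. -/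

import Mathlib

open scoped ContDiff Matrix PowerSeries

noncomputable section

/-- The parameter space `ℝ^D` with its Euclidean norm. -/
abbrev Param (D : ℕ) : Type := EuclideanSpace ℝ (Fin D)

/-- The Hessian `∇²E(θ)`, as the `D × D` matrix of second partial derivatives. -/
def hessian {D : ℕ} (E : Param D → ℝ) (θ : Param D) : Matrix (Fin D) (Fin D) ℝ :=
  Matrix.of fun i j =>
    iteratedFDeriv ℝ 2 E θ ![EuclideanSpace.single i 1, EuclideanSpace.single j 1]

/-- The truncation `∑_{p ≤ n} h^p f_p` of the formal vector field `∑_p h^p f_p`. -/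
def truncatedField {D : ℕ} (f : ℕ → Param D → Param D) (n : ℕ) (h : ℝ) (θ : Param D) : Param D :=
  ∑ p ∈ Finset.range (n + 1), h ^ p • f p θ

/-- The flow `θ' = ∑_{p ≤ n} h^p f_p(θ)` tracks one gradient descent step
`θ₀ ↦ θ₀ - h ∇E(θ₀)` with error `O(h^(n+2))` as `h → 0⁺`: for every `θ₀` and all small `h > 0`
the solution `γ` that starts at `θ₀` exists on `[0, h]`, and `γ(h)` is within `C h^(n+2)` of the
gradient descent iterate. -/
def TracksGradientDescent {D : ℕ} (E : Param D → ℝ) (f : ℕ → Param D → Param D) (n : ℕ) : Prop :=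
  ∀ θ₀ : Param D, ∃ C h₀ : ℝ, 0 < h₀ ∧ ∀ h : ℝ, 0 < h → h < h₀ →
    ∃ γ : ℝ → Param D, γ 0 = θ₀ ∧
      (∀ t ∈ Set.Icc 0 h,
        HasDerivWithinAt γ (truncatedField f n h (γ t)) (Set.Icc 0 h) t) ∧
      ‖γ h - (θ₀ - h • gradient E θ₀)‖ ≤ C * h ^ (n + 2)

/-- `∑_p h^p f_p` is the full-order modified vector field given by backward error analysis of
gradient descent on `E`: the `f_p` are smooth and do not depend on `h`, and the truncation at every
order `n` tracks the gradient descent step with error `O(h^(n+2))`. -/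
def IsBEAModifiedField {D : ℕ} (E : Param D → ℝ) (f : ℕ → Param D → Param D) : Prop :=
  (∀ p, ContDiff ℝ ∞ (f p)) ∧ ∀ n, TracksGradientDescent E f n

/-- Names of the partial derivatives of order at least one of a function of `D` variables:
`⟨m, i⟩` stands for `∂^(m+1) / ∂θ_{i 0} ⋯ ∂θ_{i m}`. -/
abbrev PartialIndex (D : ℕ) : Type := Σ m : ℕ, Fin (m + 1) → Fin D

/-- The order of the partial derivative named by an index. -/
def PartialIndex.order {D : ℕ} (v : PartialIndex D) : ℕ := v.1 + 1

/-- The value at `θ` of the partial derivative of `E` named by `v`. -/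
def partialDerivative {D : ℕ} (E : Param D → ℝ) (θ : Param D) (v : PartialIndex D) : ℝ :=
  iteratedFDeriv ℝ (v.1 + 1) E θ fun j => EuclideanSpace.single (v.2 j) 1

/-- A differential polynomial: a polynomial expression, not depending on any function, in the
names of partial derivatives. -/
abbrev DiffPoly (D : ℕ) : Type := MvPolynomial (PartialIndex D) ℝ

/-- The value at `θ` of a differential polynomial in the partial derivatives of `E`. -/
def DiffPoly.evalAt {D : ℕ} (P : DiffPoly D) (E : Param D → ℝ) (θ : Param D) : ℝ :=
  MvPolynomial.eval (partialDerivative E θ) P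

/-- The family `𝒞(∇³E)`: sums of terms, each of which contains, as a factor, a partial derivative
of order at least three. -/
def DiffPoly.IsNonPrincipal {D : ℕ} (P : DiffPoly D) : Prop :=
  ∀ m ∈ P.support, ∃ v ∈ m.support, 3 ≤ PartialIndex.order v

/-- The formal power series `∑_p h^p a_p` in `h` with coefficients `a_p` in `ℝ^D`, coordinate by
coordinate; the indeterminate of `ℝ⟦X⟧` is the learning rate `h`. -/
def formalSeries {D : ℕ} (a : ℕ → Fin D → ℝ) : Fin D → ℝ⟦X⟧ :=
  fun k => PowerSeries.mk fun p => a p k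

/-- The constant formal power series with value the vector `w`. -/
def constSeries {D : ℕ} (w : Fin D → ℝ) : Fin D → ℝ⟦X⟧ :=
  fun k => PowerSeries.C (w k)

/-- `u` is an orthonormal basis of eigenvectors of `∇²E(θ)`, with eigenvalues `ev`. -/
def IsHessianEigenbasis {D : ℕ} (E : Param D → ℝ) (θ : Param D)
    (u : OrthonormalBasis (Fin D) ℝ (Param D)) (ev : Fin D → ℝ) : Prop :=
  ∀ i, hessian E θ *ᵥ (u i).ofLp = ev i • (u i).ofLp

end

/-! Along a solution of `θ' = g(θ)`, the time derivatives are the iterated Lie derivatives of the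
identity along `g`. Taking `g = ∑ h^p f_p` and collecting powers of `h`, the coefficient of
`h^(n+1)` in the time-`h` flow is `f_n` plus terms in `f_0, …, f_(n-1)` only. This triangular system
determines the field uniquely from the flow, and the field is the modified field of gradient descent
exactly when its flow has coefficients `-∇E, 0, 0, …` (`isBEAModifiedField_iff`). That equivalence
needs a Taylor expansion with remainder, uniform for small `h` (`exists_flow_expansion`).

The system can be solved universally among differential polynomials (`modifiedField`), because
evaluation at `E` turns total derivatives into Fréchet derivatives. The partial derivatives of order
at least three generate an ideal stable under differentiation, and modulo it the Hessian `H` is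
constant. There the derivative of `H^s ∇E` along `H^t ∇E` is `H^(s+t+1) ∇E`, so the computation
reduces to power series in one variable: the field with coefficient series `L(x) = log(1 - x)/x` has
flow `exp(x L(x)) - 1 = -x`, which is the gradient descent step. By triangularity modulo the ideal,
the modified field agrees with the principal part (`modifiedField_sub_principalPart_mem`). The
eigenbasis forms follow by diagonalising `H`. -/

/-! ### Formal flows and the triangular system for the field. -/

section LieSeries

variable {M M' : Type*} [AddCommGroup M] [Module ℝ M] [AddCommGroup M'] [Module ℝ M']

/-- If `op a b` is the derivative of `a` along `b`, then `lieCoeff op f k q` is the coefficient of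
`h^q` in the `(k+1)`-st iterated Lie derivative of the identity along `∑_p h^p f_p`. -/
def lieCoeff (op : M → M → M) (f : ℕ → M) : ℕ → ℕ → M
  | 0, q => f q
  | k + 1, q => ∑ x ∈ Finset.HasAntidiagonal.antidiagonal q, op (lieCoeff op f k x.1) (f x.2)

/-- The coefficient of `h^(n+1)` in the time-`h` flow of `∑_p h^p f_p`. -/
noncomputable def flowCoeff (op : M → M → M) (f : ℕ → M) (n : ℕ) : M :=
  ∑ x ∈ Finset.HasAntidiagonal.antidiagonal n, (((x.1 + 1).factorial : ℝ)⁻¹) • lieCoeff op f x.1 x.2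

theorem lieCoeff_sub_mem {op : M → M → M} {N : Submodule ℝ M}
    (hop : ∀ a a' b b', a - a' ∈ N → b - b' ∈ N → op a b - op a' b' ∈ N)
    {f g : ℕ → M} (k : ℕ) {q : ℕ} (h : ∀ p ≤ q, f p - g p ∈ N) :
    lieCoeff op f k q - lieCoeff op g k q ∈ N := by
  induction k generalizing q with
  | zero => exact h q le_rfl
  | succ k ih =>
    simp only [lieCoeff, ← Finset.sum_sub_distrib]
    refine Submodule.sum_mem _ fun x hx => ?_
    rw [Finset.HasAntidiagonal.mem_antidiagonal] at hx
    exact hop _ _ _ _ (ih fun p hp => h p (by omega)) (h _ (by omega))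

theorem lieCoeff_congr {op : M → M → M} {f g : ℕ → M} (k : ℕ) {q : ℕ}
    (h : ∀ p ≤ q, f p = g p) : lieCoeff op f k q = lieCoeff op g k q := by
  have := lieCoeff_sub_mem (op := op) (N := ⊥) (f := f) (g := g) (q := q)
    (fun a a' b b' h₁ h₂ => by
      rw [Submodule.mem_bot, sub_eq_zero] at *
      rw [h₁, h₂]) k (fun p hp => by simp [h p hp])
  rwa [Submodule.mem_bot, sub_eq_zero] at this

theorem lieCoeff_map {op : M → M → M} {op' : M' → M' → M'} (φ : M →ₗ[ℝ] M')
    (hφ : ∀ a b, op' (φ a) (φ b) = φ (op a b)) (f : ℕ → M) (k q : ℕ) :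
    lieCoeff op' (fun p => φ (f p)) k q = φ (lieCoeff op f k q) := by
  induction k generalizing q with
  | zero => rfl
  | succ k ih => simp [lieCoeff, ih, hφ]

/-- Carries the solution found among differential polynomials over to actual vector fields. -/
theorem flowCoeff_map {op : M → M → M} {op' : M' → M' → M'} (φ : M →ₗ[ℝ] M')
    (hφ : ∀ a b, op' (φ a) (φ b) = φ (op a b)) (f : ℕ → M) (n : ℕ) :
    flowCoeff op' (fun p => φ (f p)) n = φ (flowCoeff op f n) := by
  simp [flowCoeff, lieCoeff_map φ hφ]

theorem flowCoeff_eq_add (op : M → M → M) (f : ℕ → M) (n : ℕ) :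
    flowCoeff op f n = f n + ∑ x ∈ Finset.HasAntidiagonal.antidiagonal n with x.1 ≠ 0,
      (((x.1 + 1).factorial : ℝ)⁻¹) • lieCoeff op f x.1 x.2 := by
  rw [flowCoeff, ← Finset.sum_filter_add_sum_filter_not _ (fun x => x.1 = 0)]
  congr 1
  have : (Finset.HasAntidiagonal.antidiagonal n).filter (fun x => x.1 = 0) = {(0, n)} := by
    ext ⟨a, b⟩
    simp only [Finset.mem_filter, Finset.HasAntidiagonal.mem_antidiagonal, Finset.mem_singleton,
      Prod.mk.injEq]
    omega
  rw [this]
  simp [lieCoeff]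

/-- Triangularity modulo `N`: in the `n`-th flow coefficient every term other than the `n`-th field
coefficient involves smaller indices only, so strong induction applies. `N = ⊥` gives uniqueness;
the nonprincipal vectors give the principal part. -/
theorem sub_mem_of_flowCoeff_sub_mem {op : M → M → M} {N : Submodule ℝ M}
    (hop : ∀ a a' b b', a - a' ∈ N → b - b' ∈ N → op a b - op a' b' ∈ N)
    {f g : ℕ → M} (h : ∀ n, flowCoeff op f n - flowCoeff op g n ∈ N) (n : ℕ) :
    f n - g n ∈ N := by
  induction n using Nat.strong_induction_on with
  | _ n ih =>
    have hn := h n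
    rw [flowCoeff_eq_add, flowCoeff_eq_add, add_sub_add_comm, ← Finset.sum_sub_distrib] at hn
    refine (Submodule.add_mem_iff_left _ (Submodule.sum_mem _ fun x hx => ?_)).1 hn
    rw [Finset.mem_filter, Finset.HasAntidiagonal.mem_antidiagonal] at hx
    rw [← smul_sub]
    exact N.smul_mem _ (lieCoeff_sub_mem hop _ fun p hp => ih p (by omega))

theorem eq_of_flowCoeff_eq {op : M → M → M} {f g : ℕ → M}
    (h : ∀ n, flowCoeff op f n = flowCoeff op g n) : f = g := by
  funext n
  have := sub_mem_of_flowCoeff_sub_mem (op := op) (N := ⊥) (f := f) (g := g)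
    (fun a a' b b' h₁ h₂ => by
      rw [Submodule.mem_bot, sub_eq_zero] at *
      rw [h₁, h₂]) (fun n => by simp [h n]) n
  rwa [Submodule.mem_bot, sub_eq_zero] at this

/-- The formal field whose time-`h` flow has the prescribed coefficients `t`. -/
noncomputable def fieldOfFlow (op : M → M → M) (t : ℕ → M) (n : ℕ) : M :=
  t n - ∑ x ∈ Finset.HasAntidiagonal.antidiagonal n with x.1 ≠ 0, (((x.1 + 1).factorial : ℝ)⁻¹) •
    -- The guard serves well-founded recursion only: `x.1 ≠ 0` forces `x.2 < n`, so the default `0`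
    -- is never read.
    lieCoeff op (fun p => if p < n then fieldOfFlow op t p else 0) x.1 x.2
termination_by n

theorem flowCoeff_fieldOfFlow (op : M → M → M) (t : ℕ → M) (n : ℕ) :
    flowCoeff op (fieldOfFlow op t) n = t n := by
  rw [flowCoeff_eq_add, fieldOfFlow, sub_add_eq_add_sub, sub_eq_iff_eq_add]
  congr 1
  refine Finset.sum_congr rfl fun x hx => ?_
  rw [Finset.mem_filter, Finset.HasAntidiagonal.mem_antidiagonal] at hx
  rw [lieCoeff_congr _ fun p hp => (if_pos (show p < n by omega)).symm]

end LieSeries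

/-! ### The identity `exp(log(1 - x)) = 1 - x`, coefficient by coefficient. -/

section Logarithm

open PowerSeries

/-- The series `log(1 - x) / x`. -/
noncomputable def logSeries : ℝ⟦X⟧ := PowerSeries.mk fun p => -1 / ((p : ℝ) + 1)

theorem derivative_X_mul_logSeries :
    (1 - X) * derivative ℝ (X * logSeries) = -1 := by
  have h : derivative ℝ (X * logSeries) = -PowerSeries.mk 1 := by
    ext n
    rw [coeff_derivative, coeff_succ_X_mul, logSeries, coeff_mk]
    simp
    field_simp
  rw [h, mul_neg, mul_comm, PowerSeries.mk_one_mul_one_sub_eq_one]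

/-- Truncations of `exp (log (1 - x))`. -/
noncomputable def expLog (N : ℕ) : ℝ⟦X⟧ :=
  ∑ k ∈ Finset.range (N + 1), ((k.factorial : ℝ)⁻¹) • (X * logSeries) ^ k

theorem coeff_X_mul_logSeries_pow (k n : ℕ) :
    coeff n ((X * logSeries) ^ k) = if k ≤ n then coeff (n - k) (logSeries ^ k) else 0 := by
  rw [mul_pow, coeff_X_pow_mul']

/-- The series `X * logSeries` has no constant term, so its `k`-th power starts at `X^k` and later
summands do not affect the coefficient. -/
theorem coeff_expLog_of_le {n N : ℕ} (h : n ≤ N) : coeff n (expLog N) = coeff n (expLog n) := by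
  induction N, h using Nat.le_induction with
  | base => rfl
  | succ N h ih =>
    rw [expLog, Finset.sum_range_succ, map_add, ← expLog, ih, coeff_smul,
      coeff_X_mul_logSeries_pow, if_neg (by omega), smul_zero, add_zero]

/-- The equation `(1 - x) y' = -y` of `y = exp(log(1 - x))`; differentiating a truncated exponential
lowers the truncation by one. -/
theorem one_sub_X_mul_derivative_expLog (N : ℕ) :
    (1 - X) * derivative ℝ (expLog (N + 1)) = -expLog N := by
  have h := derivative_X_mul_logSeries
  rw [expLog, Finset.sum_range_succ', map_add, map_sum, expLog, ← Finset.sum_neg_distrib]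
  rw [pow_zero, Derivation.map_smul, Derivation.map_one_eq_zero, smul_zero, add_zero,
    Finset.mul_sum]
  refine Finset.sum_congr rfl fun k _ => ?_
  have hk : ((k + 1).factorial : ℝ)⁻¹ * ((k + 1 : ℕ) : ℝ) = ((k.factorial : ℝ))⁻¹ := by
    rw [Nat.factorial_succ]
    push_cast
    field_simp
  rw [Derivation.map_smul, Derivation.leibniz_pow, ← Nat.cast_smul_eq_nsmul ℝ (k + 1), smul_smul,
    hk, mul_smul_comm, Nat.add_sub_cancel, smul_eq_mul, mul_left_comm, h, mul_neg_one, smul_neg]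

theorem coeff_expLog_succ (n : ℕ) :
    coeff (n + 1) (expLog (n + 1)) = if n = 0 then -1 else 0 := by
  -- The differential equation as a recursion. The factor `n - 1` vanishes at `n = 1`, which kills
  -- every coefficient from the second on.
  have key : ∀ n : ℕ, coeff (n + 1) (expLog (n + 1)) * ((n : ℝ) + 1) =
      ((n : ℝ) - 1) * coeff n (expLog n) := by
    intro n
    have h := congrArg (coeff n) (one_sub_X_mul_derivative_expLog n)
    rw [sub_mul, one_mul, map_sub, map_neg] at h
    cases n with
    | zero =>
      rw [coeff_zero_X_mul, coeff_derivative] at h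
      simp at h ⊢
      linarith
    | succ n =>
      rw [coeff_succ_X_mul, coeff_derivative, coeff_derivative,
        coeff_expLog_of_le (show n + 1 ≤ n + 1 + 1 by omega)] at h
      push_cast at h ⊢
      linarith
  induction n with
  | zero =>
    have := key 0
    have h0 : coeff 0 (expLog 0) = 1 := by simp [expLog]
    rw [h0] at this
    simpa using this
  | succ n ih =>
    have h := key (n + 1)
    rw [ih] at h
    have : coeff (n + 1 + 1) (expLog (n + 1 + 1)) * (((n + 1 : ℕ) : ℝ) + 1) = 0 := by
      rw [h]
      by_cases hn : n = 0 <;> simp [hn]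
    simpa using (mul_eq_zero.1 this).resolve_right (by positivity)

theorem sum_coeff_logSeries_pow (n : ℕ) :
    ∑ x ∈ Finset.HasAntidiagonal.antidiagonal n,
      (((x.1 + 1).factorial : ℝ)⁻¹) * coeff x.2 (logSeries ^ (x.1 + 1)) =
        if n = 0 then -1 else 0 := by
  rw [← coeff_expLog_succ n, expLog, Finset.sum_range_succ', map_add, map_sum,
    Finset.Nat.sum_antidiagonal_eq_sum_range_succ_mk]
  simp only [coeff_smul, coeff_X_mul_logSeries_pow, smul_eq_mul]
  rw [pow_zero, coeff_one, if_neg (show n + 1 - 0 ≠ 0 by omega)]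
  simp only [ite_self, mul_zero, add_zero]
  refine Finset.sum_congr rfl fun k hk => ?_
  rw [Finset.mem_range] at hk
  rw [if_pos (by omega), Nat.add_sub_add_right]

end Logarithm

/-- The derivative of a vector field along another. -/
noncomputable def lieOp {V : Type*} [NormedAddCommGroup V] [NormedSpace ℝ V] (a b : V → V) :
    V → V :=
  fun x => fderiv ℝ a x (b x)

/-! ### Differential polynomials modulo derivatives of order at least three. -/

section DifferentialPolynomials

variable {D : ℕ}

/-- The derivation `∂/∂θ_j` on differential polynomials. -/
noncomputable def totalDeriv (j : Fin D) : Derivation ℝ (DiffPoly D) (DiffPoly D) :=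
  MvPolynomial.mkDerivation ℝ fun v => MvPolynomial.X ⟨v.1 + 1, Fin.cons j v.2⟩

theorem totalDeriv_X (j : Fin D) (v : PartialIndex D) :
    totalDeriv j (MvPolynomial.X v) = MvPolynomial.X ⟨v.1 + 1, Fin.cons j v.2⟩ :=
  MvPolynomial.mkDerivation_X _ _ _

/-- The derivative of the vector field `a` along the vector field `b`. -/
noncomputable def polyLie (a b : Fin D → DiffPoly D) : Fin D → DiffPoly D :=
  fun i => ∑ j, b j * totalDeriv j (a i)

theorem polyLie_smul_smul (r s : ℝ) (a b : Fin D → DiffPoly D) :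
    polyLie (r • a) (s • b) = (r * s) • polyLie a b := by
  funext i
  simp only [polyLie, Pi.smul_apply, Derivation.map_smul, Finset.smul_sum]
  refine Finset.sum_congr rfl fun j _ => ?_
  rw [smul_mul_smul_comm, mul_comm r s]

variable (D) in
/-- The ideal of differential polynomials generated by the derivatives of order at least three. -/
noncomputable def nonPrincipalIdeal : Ideal (DiffPoly D) :=
  Ideal.span (MvPolynomial.X '' {v : PartialIndex D | 3 ≤ v.order})

theorem mem_nonPrincipalIdeal {P : DiffPoly D} : P ∈ nonPrincipalIdeal D ↔ P.IsNonPrincipal := by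
  rw [nonPrincipalIdeal, MvPolynomial.mem_ideal_span_X_image]
  refine forall₂_congr fun m _ => exists_congr fun v => ?_
  rw [Finsupp.mem_support_iff, and_comm, Set.mem_ofPred_eq]

theorem X_mem_nonPrincipalIdeal {v : PartialIndex D} (hv : 3 ≤ v.order) :
    MvPolynomial.X v ∈ nonPrincipalIdeal D :=
  Ideal.subset_span ⟨v, by rwa [Set.mem_ofPred_eq], rfl⟩

theorem totalDeriv_mem_nonPrincipalIdeal (j : Fin D) {P : DiffPoly D}
    (hP : P ∈ nonPrincipalIdeal D) : totalDeriv j P ∈ nonPrincipalIdeal D := by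
  refine Submodule.span_induction ?_ ?_ ?_ ?_ hP
  · rintro _ ⟨v, hv, rfl⟩
    rw [Set.mem_ofPred_eq] at hv
    rw [totalDeriv_X]
    exact X_mem_nonPrincipalIdeal (Nat.le_succ_of_le hv)
  · rw [map_zero]
    exact zero_mem _
  · intro a b _ _ ha hb
    rw [map_add]
    exact add_mem ha hb
  · intro a b hb h
    rw [smul_eq_mul, Derivation.leibniz]
    exact add_mem (Ideal.mul_mem_left _ _ h) (Ideal.mul_mem_right _ _ hb)

variable (D) in
/-- The vectors with entries in `nonPrincipalIdeal`. -/
noncomputable def nonPrincipalVectors : Submodule ℝ (Fin D → DiffPoly D) :=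
  Submodule.pi Set.univ fun _ => (nonPrincipalIdeal D).restrictScalars ℝ

theorem mem_nonPrincipalVectors {a : Fin D → DiffPoly D} :
    a ∈ nonPrincipalVectors D ↔ ∀ i, a i ∈ nonPrincipalIdeal D := by
  simp [nonPrincipalVectors, Submodule.mem_pi]

/-- Since the ideal is stable under `totalDeriv`, `polyLie` descends to the quotient. -/
theorem polyLie_sub_mem (a a' b b' : Fin D → DiffPoly D) (ha : a - a' ∈ nonPrincipalVectors D)
    (hb : b - b' ∈ nonPrincipalVectors D) :
    polyLie a b - polyLie a' b' ∈ nonPrincipalVectors D := by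
  rw [mem_nonPrincipalVectors] at *
  intro i
  rw [Pi.sub_apply, polyLie, polyLie, ← Finset.sum_sub_distrib]
  refine Ideal.sum_mem _ fun j _ => ?_
  have : b j * totalDeriv j (a i) - b' j * totalDeriv j (a' i) =
      b j * totalDeriv j ((a - a') i) + (b - b') j * totalDeriv j (a' i) := by
    rw [Pi.sub_apply, Pi.sub_apply, map_sub]
    ring
  rw [this]
  exact add_mem (Ideal.mul_mem_left _ _ (totalDeriv_mem_nonPrincipalIdeal j (ha i)))
    (Ideal.mul_mem_right _ _ (hb j))

/-- The gradient, as a vector of differential polynomials. -/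
noncomputable def gradPoly : Fin D → DiffPoly D := fun l => MvPolynomial.X ⟨0, fun _ => l⟩

/-- The Hessian, as a matrix of differential polynomials. -/
noncomputable def hessPoly : Matrix (Fin D) (Fin D) (DiffPoly D) :=
  Matrix.of fun l j => MvPolynomial.X ⟨1, Fin.cons j fun _ => l⟩

/-- Differentiating an entry of the Hessian gives a third derivative, so by Leibniz powers of the
Hessian are constant modulo the ideal. -/
theorem totalDeriv_hessPoly_pow_mem (j : Fin D) (s : ℕ) (i l : Fin D) :
    totalDeriv j ((hessPoly ^ s) i l) ∈ nonPrincipalIdeal D := by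
  induction s generalizing l with
  | zero =>
    have : totalDeriv j ((1 : Matrix (Fin D) (Fin D) (DiffPoly D)) i l) = 0 := by
      rw [Matrix.one_apply]
      split_ifs
      · exact Derivation.map_one_eq_zero _
      · exact map_zero _
    rw [pow_zero, this]
    exact zero_mem _
  | succ s ih =>
    rw [pow_succ, Matrix.mul_apply, map_sum]
    refine Ideal.sum_mem _ fun r _ => ?_
    rw [Derivation.leibniz]
    refine add_mem (Ideal.mul_mem_left _ _ ?_) (Ideal.mul_mem_left _ _ (ih r))
    rw [hessPoly, Matrix.of_apply, totalDeriv_X]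
    exact X_mem_nonPrincipalIdeal le_rfl

theorem totalDeriv_hessPoly_pow_mulVec (j : Fin D) (s : ℕ) (i : Fin D) :
    totalDeriv j ((hessPoly ^ s *ᵥ gradPoly) i) - (hessPoly ^ (s + 1)) i j ∈
      nonPrincipalIdeal D := by
  rw [pow_succ, Matrix.mul_apply, Matrix.mulVec, dotProduct, map_sum, ← Finset.sum_sub_distrib]
  refine Ideal.sum_mem _ fun l _ => ?_
  have : totalDeriv j (gradPoly l) = hessPoly l j := totalDeriv_X _ _
  rw [Derivation.leibniz, this, smul_eq_mul, add_sub_cancel_left]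
  exact Ideal.mul_mem_left _ _ (totalDeriv_hessPoly_pow_mem j s i l)

theorem polyLie_hessPoly_pow_mulVec (s t : ℕ) :
    polyLie (hessPoly ^ s *ᵥ gradPoly) (hessPoly ^ t *ᵥ gradPoly) -
      hessPoly ^ (s + t + 1) *ᵥ gradPoly ∈ nonPrincipalVectors D := by
  rw [mem_nonPrincipalVectors]
  intro i
  have h : (hessPoly ^ (s + t + 1) *ᵥ gradPoly) i =
      ∑ j, (hessPoly ^ (s + 1)) i j * (hessPoly ^ t *ᵥ gradPoly (D := D)) j := by
    rw [show s + t + 1 = (s + 1) + t by omega, pow_add _ (s + 1), ← Matrix.mulVec_mulVec]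
    rfl
  rw [Pi.sub_apply, h, polyLie, ← Finset.sum_sub_distrib]
  refine Ideal.sum_mem _ fun j _ => ?_
  rw [mul_comm ((hessPoly ^ (s + 1)) i j), ← mul_sub]
  exact Ideal.mul_mem_left _ _ (totalDeriv_hessPoly_pow_mulVec j s i)

variable (D) in
/-- The principal part `-1/(p+1) (∇²E)^p ∇E` of the modified field. -/
noncomputable def principalPart (p : ℕ) : Fin D → DiffPoly D :=
  (-1 / ((p : ℝ) + 1)) • (hessPoly ^ p *ᵥ gradPoly)

/-- Modulo the ideal, exponents of the Hessian add up with one extra factor per Lie derivative, and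
the scalars form a Cauchy product; each Lie derivative thus multiplies by one more `logSeries`. -/
theorem lieCoeff_principalPart (k q : ℕ) :
    lieCoeff polyLie (principalPart D) k q -
      PowerSeries.coeff q (logSeries ^ (k + 1)) • (hessPoly ^ (k + q) *ᵥ gradPoly) ∈
        nonPrincipalVectors D := by
  induction k generalizing q with
  | zero => simp [lieCoeff, principalPart, logSeries]
  | succ k ih =>
    rw [lieCoeff, pow_succ, PowerSeries.coeff_mul, Finset.sum_smul, ← Finset.sum_sub_distrib]
    refine Submodule.sum_mem _ fun x hx => ?_
    rw [Finset.HasAntidiagonal.mem_antidiagonal] at hx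
    have h₁ := polyLie_sub_mem _ _ (principalPart D x.2) (principalPart D x.2) (ih x.1)
      (by rw [sub_self]; exact zero_mem _)
    have h₂ := (nonPrincipalVectors D).smul_mem
      (PowerSeries.coeff x.1 (logSeries ^ (k + 1)) * (-1 / ((x.2 : ℝ) + 1)))
      (polyLie_hessPoly_pow_mulVec (D := D) (k + x.1) x.2)
    rw [smul_sub, ← polyLie_smul_smul] at h₂
    have h₃ := add_mem h₁ h₂
    rw [← principalPart, sub_add_sub_cancel] at h₃
    rwa [logSeries, PowerSeries.coeff_mk, ← logSeries, show k + 1 + q = k + x.1 + x.2 + 1 by omega]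

variable (D) in
/-- The flow coefficients of a gradient descent step: `-∇E` in order one, zero afterwards. -/
noncomputable def descentCoeff (n : ℕ) : Fin D → DiffPoly D := if n = 0 then -gradPoly else 0

theorem flowCoeff_principalPart (n : ℕ) :
    flowCoeff polyLie (principalPart D) n - descentCoeff D n ∈ nonPrincipalVectors D := by
  have h : descentCoeff D n = ∑ x ∈ Finset.HasAntidiagonal.antidiagonal n,
      (((x.1 + 1).factorial : ℝ)⁻¹) • (PowerSeries.coeff x.2 (logSeries ^ (x.1 + 1)) •
        (hessPoly ^ (x.1 + x.2) *ᵥ gradPoly)) := by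
    have : ∀ x ∈ Finset.HasAntidiagonal.antidiagonal n,
        (((x.1 + 1).factorial : ℝ)⁻¹) • (PowerSeries.coeff x.2 (logSeries ^ (x.1 + 1)) •
          (hessPoly ^ (x.1 + x.2) *ᵥ gradPoly (D := D))) =
        ((((x.1 + 1).factorial : ℝ)⁻¹) * PowerSeries.coeff x.2 (logSeries ^ (x.1 + 1))) •
          (hessPoly ^ n *ᵥ gradPoly) := by
      intro x hx
      rw [Finset.HasAntidiagonal.mem_antidiagonal] at hx
      rw [smul_smul, hx]
    rw [Finset.sum_congr rfl this, ← Finset.sum_smul, sum_coeff_logSeries_pow, descentCoeff]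
    split_ifs with hn
    · simp [hn]
    · simp
  rw [h, flowCoeff, ← Finset.sum_sub_distrib]
  refine Submodule.sum_mem _ fun x _ => ?_
  rw [← smul_sub]
  exact Submodule.smul_mem _ _ (lieCoeff_principalPart _ _)

variable (D) in
/-- The modified field of gradient descent, as vectors of differential polynomials. -/
noncomputable def modifiedField : ℕ → Fin D → DiffPoly D := fieldOfFlow polyLie (descentCoeff D)

theorem modifiedField_sub_principalPart_mem (p : ℕ) :
    modifiedField D p - principalPart D p ∈ nonPrincipalVectors D := by
  refine sub_mem_of_flowCoeff_sub_mem polyLie_sub_mem (fun n => ?_) p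
  rw [modifiedField, flowCoeff_fieldOfFlow, ← neg_sub]
  exact neg_mem (flowCoeff_principalPart n)

end DifferentialPolynomials

/-! ### Evaluation of differential polynomials at a smooth function. -/

section Evaluation

variable {D : ℕ} {E : Param D → ℝ}

theorem differentiable_iteratedFDeriv_of_smooth (hE : ContDiff ℝ ∞ E) (m : ℕ) :
    Differentiable ℝ (iteratedFDeriv ℝ m E) :=
  hE.differentiable_iteratedFDeriv (by exact_mod_cast ENat.natCast_lt_top m)

theorem hasFDerivAt_partialDerivative (hE : ContDiff ℝ ∞ E) (v : PartialIndex D) (θ : Param D) :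
    HasFDerivAt (fun θ => partialDerivative E θ v)
      (∑ j, partialDerivative E θ ⟨v.1 + 1, Fin.cons j v.2⟩ •
        (EuclideanSpace.proj j : Param D →L[ℝ] ℝ)) θ := by
  have hd := differentiable_iteratedFDeriv_of_smooth hE (v.1 + 1) θ
  have h := hd.hasFDerivAt.continuousMultilinear_apply_const
    fun j => EuclideanSpace.single (v.2 j) (1 : ℝ)
  refine h.congr_fderiv ?_
  ext w
  have hw : w = ∑ j, w j • EuclideanSpace.single j (1 : ℝ) := by
    ext i
    simp [Finset.sum_apply, Pi.single_apply]
  conv_lhs => rw [hw]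
  rw [map_sum, sum_apply]
  refine Finset.sum_congr rfl fun j _ => ?_
  rw [map_smul, smul_eq_mul, mul_comm, smul_apply]
  simp only [smul_eq_mul, partialDerivative]
  -- The new direction enters the first slot, matching the `Fin.cons` in `totalDeriv`.
  rw [iteratedFDeriv_succ_apply_left]
  rfl

theorem hasFDerivAt_evalAt (hE : ContDiff ℝ ∞ E) (P : DiffPoly D) (θ : Param D) :
    HasFDerivAt (fun θ => P.evalAt E θ)
      (∑ j, (totalDeriv j P).evalAt E θ • (EuclideanSpace.proj j : Param D →L[ℝ] ℝ)) θ := by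
  induction P using MvPolynomial.induction_on with
  | C r =>
    have h : ∀ j : Fin D, totalDeriv j (MvPolynomial.C r) = 0 :=
      fun j => (totalDeriv j).map_algebraMap r
    simpa [DiffPoly.evalAt, h] using hasFDerivAt_const r θ
  | add p q hp hq =>
    have := hp.fun_add hq
    rw [← Finset.sum_add_distrib] at this
    simp only [← add_smul] at this
    simpa [DiffPoly.evalAt] using this
  | mul_X p v hp =>
    have := hp.fun_mul (hasFDerivAt_partialDerivative hE v θ)
    rw [Finset.smul_sum, Finset.smul_sum, ← Finset.sum_add_distrib] at this
    simp only [smul_smul, ← add_smul] at this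
    simpa [DiffPoly.evalAt, totalDeriv_X, mul_comm] using this

theorem contDiff_evalAt (hE : ContDiff ℝ ∞ E) (P : DiffPoly D) :
    ContDiff ℝ ∞ (fun θ => P.evalAt E θ) := by
  induction P using MvPolynomial.induction_on with
  | C r => simpa [DiffPoly.evalAt] using contDiff_const
  | add p q hp hq => simpa [DiffPoly.evalAt] using hp.add hq
  | mul_X p v hp =>
    have h : ContDiff ℝ ∞ (fun θ => partialDerivative E θ v) :=
      (ContinuousMultilinearMap.apply ℝ (fun _ : Fin (v.1 + 1) => Param D) ℝ
        fun j => EuclideanSpace.single (v.2 j) 1).contDiff.comp (hE.iteratedFDeriv_right (m := ∞) (i := v.1 + 1) le_rfl)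
    simpa [DiffPoly.evalAt] using hp.mul h

/-- The vector field named by a vector of differential polynomials. -/
noncomputable def fieldEval (E : Param D → ℝ) :
    (Fin D → DiffPoly D) →ₗ[ℝ] (Param D → Param D) where
  toFun a θ := WithLp.toLp 2 fun i => (a i).evalAt E θ
  map_add' a b := by
    ext θ i
    simp [DiffPoly.evalAt]
  map_smul' r a := by
    ext θ i
    simp [DiffPoly.evalAt, MvPolynomial.smul_eval]

theorem fieldEval_apply (a : Fin D → DiffPoly D) (θ : Param D) (i : Fin D) :
    fieldEval E a θ i = (a i).evalAt E θ := rfl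

theorem contDiff_fieldEval (hE : ContDiff ℝ ∞ E) (a : Fin D → DiffPoly D) :
    ContDiff ℝ ∞ (fieldEval E a) :=
  contDiff_euclidean.2 fun i => contDiff_evalAt hE (a i)

theorem lieOp_fieldEval (hE : ContDiff ℝ ∞ E) (a b : Fin D → DiffPoly D) :
    lieOp (fieldEval E a) (fieldEval E b) = fieldEval E (polyLie a b) := by
  ext θ i
  have h : DifferentiableAt ℝ (fieldEval E a) θ :=
    (contDiff_fieldEval hE a).differentiable (by simp) θ
  have h₁ := ((EuclideanSpace.proj i : Param D →L[ℝ] ℝ).hasFDerivAt.comp θ h.hasFDerivAt).unique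
    (hasFDerivAt_evalAt hE (a i) θ)
  have h₂ : (fderiv ℝ (fieldEval E a) θ (fieldEval E b θ)) i = _ :=
    congrArg (fun L => L (fieldEval E b θ)) h₁
  rw [lieOp, h₂, fieldEval_apply, polyLie]
  simp [DiffPoly.evalAt, fieldEval_apply, mul_comm]

theorem fieldEval_gradPoly : fieldEval E gradPoly = gradient E := by
  ext θ i
  rw [fieldEval_apply, gradPoly, DiffPoly.evalAt, MvPolynomial.eval_X, partialDerivative]
  have : gradient E θ i = inner ℝ (gradient E θ) (EuclideanSpace.single i 1) := by
    rw [real_inner_comm, EuclideanSpace.inner_single_left]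
    simp
  rw [this, gradient, InnerProductSpace.toDual_symm_apply]
  simp [iteratedFDeriv_one_apply]

theorem hessian_isSymm (hE : ContDiff ℝ ∞ E) (θ : Param D) : (hessian E θ).IsSymm := by
  ext i j
  have h : IsSymmSndFDerivAt ℝ E θ := hE.contDiffAt.isSymmSndFDerivAt (by
    rw [minSmoothness_of_isRCLikeNormedField]
    exact WithTop.coe_le_coe.2 (le_top : (2 : ℕ∞) ≤ ⊤))
  simp only [Matrix.transpose_apply, hessian, Matrix.of_apply, iteratedFDeriv_two_apply]
  exact h.eq _ _

theorem map_eval_hessPoly (hE : ContDiff ℝ ∞ E) (θ : Param D) :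
    hessPoly.map (MvPolynomial.eval (partialDerivative E θ)) = hessian E θ := by
  -- The `(l, j)` entry of `hessPoly` lists `j` first, so evaluation yields the transpose of
  -- `hessian`.
  rw [← (hessian_isSymm hE θ).eq]
  ext i j
  simp only [Matrix.map_apply, hessPoly, Matrix.of_apply, MvPolynomial.eval_X, partialDerivative,
    Matrix.transpose_apply, hessian]
  congr 1
  funext r
  fin_cases r <;> rfl

theorem fieldEval_principalPart (hE : ContDiff ℝ ∞ E) (p : ℕ) (θ : Param D) :
    (fieldEval E (principalPart D p) θ).ofLp =
      (-1 / ((p : ℝ) + 1)) • ((hessian E θ) ^ p *ᵥ (gradient E θ).ofLp) := by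
  rw [principalPart, map_smul, Pi.smul_apply, WithLp.ofLp_smul]
  congr 1
  rw [← map_eval_hessPoly hE, ← fieldEval_gradPoly]
  funext i
  have := RingHom.map_mulVec (MvPolynomial.eval (partialDerivative E θ)) (hessPoly ^ p) gradPoly i
  rw [fieldEval_apply, DiffPoly.evalAt, this, ← RingHom.mapMatrix_apply, map_pow]
  rfl

theorem flowCoeff_fieldEval_modifiedField (hE : ContDiff ℝ ∞ E) (n : ℕ) :
    flowCoeff lieOp (fun p => fieldEval E (modifiedField D p)) n =
      if n = 0 then -gradient E else 0 := by
  rw [flowCoeff_map (fieldEval E) (lieOp_fieldEval hE), modifiedField, flowCoeff_fieldOfFlow,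
    descentCoeff, ← fieldEval_gradPoly]
  split_ifs <;> simp

end Evaluation

/-! ### Existence and Taylor expansion of the true flow. -/

section FlowExpansion

open Set

variable {V : Type*} [NormedAddCommGroup V] [NormedSpace ℝ V]

/-- Induction on `N`: the remainder vanishes at `0`, its derivative is the remainder for the shifted
chain, and a bound on that derivative integrates to the bound wanted. -/
theorem norm_sub_taylor_le {N : ℕ} {h K : ℝ} {φ : ℕ → ℝ → V}
    (hφ : ∀ k < N, ∀ t ∈ Icc 0 h, HasDerivWithinAt (φ k) (φ (k + 1) t) (Icc 0 h) t)
    (hK : ∀ t ∈ Icc 0 h, ‖φ N t‖ ≤ K) :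
    ∀ t ∈ Icc 0 h, ‖φ 0 t - ∑ k ∈ Finset.range N, (t ^ k / (k.factorial : ℝ)) • φ k 0‖ ≤
      K * (t ^ N / (N.factorial : ℝ)) := by
  induction N generalizing φ with
  | zero => simpa using hK
  | succ N ih =>
    have ih' := ih (φ := fun k => φ (k + 1)) (fun k hk => hφ (k + 1) (by omega)) hK
    have hpow : ∀ (k : ℕ) (t : ℝ), HasDerivAt (fun t : ℝ => t ^ (k + 1) / ((k + 1).factorial : ℝ))
        (t ^ k / (k.factorial : ℝ)) t := by
      intro k t
      refine ((hasDerivAt_pow (k + 1) t).div_const ((k + 1).factorial : ℝ)).congr_deriv ?_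
      rw [Nat.factorial_succ]
      push_cast
      field_simp
    have hderiv : ∀ t ∈ Icc 0 h, HasDerivWithinAt
        (fun t => φ 0 t - ∑ k ∈ Finset.range (N + 1), (t ^ k / (k.factorial : ℝ)) • φ k 0)
        (φ 1 t - ∑ k ∈ Finset.range N, (t ^ k / (k.factorial : ℝ)) • φ (k + 1) 0) (Icc 0 h) t := by
      intro t ht
      refine (hφ 0 (by omega) t ht).fun_sub ?_
      simp only [Finset.sum_range_succ' _ N, pow_zero]
      refine HasDerivWithinAt.add_const _ (HasDerivWithinAt.fun_sum fun k _ => ?_)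
      exact ((hpow k t).smul_const _).hasDerivWithinAt
    refine image_norm_le_of_norm_deriv_right_le_deriv_boundary
      (fun t ht => (hderiv t ht).continuousWithinAt)
      (fun t ht => (hderiv t (Ico_subset_Icc_self ht)).mono_of_mem_nhdsWithin
        (Icc_mem_nhdsGE_of_mem ht)) ?_ (fun t => (hpow N t).const_mul K)
      (fun t ht => ih' t (Ico_subset_Icc_self ht))
    simp [Finset.sum_range_succ']

theorem sum_range_sum_antidiagonal {V : Type*} [AddCommMonoid V] {A B Q : ℕ} (hQ : A + B ≤ Q + 1) {F : ℕ → ℕ → V}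
    (hA : ∀ a b, A ≤ a → F a b = 0) (hB : ∀ a b, B ≤ b → F a b = 0) :
    ∑ q ∈ Finset.range Q, ∑ x ∈ Finset.HasAntidiagonal.antidiagonal q, F x.1 x.2 =
      ∑ a ∈ Finset.range A, ∑ b ∈ Finset.range B, F a b := by
  rw [← Finset.sum_product', ← Finset.sum_fiberwise_of_maps_to (g := fun x : ℕ × ℕ => x.1 + x.2)
    (t := Finset.range Q)]
  · refine Finset.sum_congr rfl fun q _ => (Finset.sum_subset ?_ ?_).symm
    · intro x hx
      rw [Finset.mem_filter] at hx
      exact Finset.HasAntidiagonal.mem_antidiagonal.2 hx.2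
    · intro x hx hx'
      rw [Finset.HasAntidiagonal.mem_antidiagonal] at hx
      simp only [Finset.mem_filter, Finset.mem_product, Finset.mem_range, hx, and_true,
        not_and_or, not_lt] at hx'
      exact hx'.elim (hA _ _) (hB _ _)
  · intro x hx
    simp only [Finset.mem_product, Finset.mem_range] at hx ⊢
    omega

theorem contDiff_lieOp {a b : V → V} (ha : ContDiff ℝ ∞ a) (hb : ContDiff ℝ ∞ b) :
    ContDiff ℝ ∞ (lieOp a b) :=
  (ha.fderiv_right (m := ∞) le_rfl).clm_apply hb

theorem contDiff_lieCoeff {f : ℕ → V → V} (hf : ∀ p, ContDiff ℝ ∞ (f p)) (k q : ℕ) :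
    ContDiff ℝ ∞ (lieCoeff lieOp f k q) := by
  induction k generalizing q with
  | zero => exact hf q
  | succ k ih =>
    have : lieCoeff lieOp f (k + 1) q = fun x => ∑ y ∈ Finset.HasAntidiagonal.antidiagonal q,
        lieOp (lieCoeff lieOp f k y.1) (f y.2) x := by
      funext x
      simp [lieCoeff]
    rw [this]
    exact ContDiff.sum fun y _ => contDiff_lieOp (ih y.1) (hf y.2)

theorem lieCoeff_eq_zero {f : ℕ → V → V} {n : ℕ} (hf : ∀ p, n < p → f p = 0) (k : ℕ) {q : ℕ}
    (hq : (k + 1) * n < q) : lieCoeff lieOp f k q = 0 := by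
  induction k generalizing q with
  | zero => exact hf q (by simpa using hq)
  | succ k ih =>
    refine Finset.sum_eq_zero fun x hx => ?_
    rw [Finset.HasAntidiagonal.mem_antidiagonal] at hx
    have : (k + 1 + 1) * n = (k + 1) * n + n := by ring
    rcases lt_or_ge n x.2 with h | h
    · funext y
      simp [lieOp, hf _ h]
    · funext y
      simp [lieOp, ih (q := x.1) (by omega)]

/-- The iterated Lie derivatives of the identity along `g`, starting with the first, which is
`g`. -/
noncomputable def lieIter (g : V → V) : ℕ → V → V
  | 0 => g
  | k + 1 => lieOp (lieIter g k) g

theorem lieIter_eq_sum {f : ℕ → V → V} (hf : ∀ p, ContDiff ℝ ∞ (f p)) {n : ℕ}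
    (hn : ∀ p, n < p → f p = 0) (h : ℝ) (k : ℕ) :
    lieIter (fun x => ∑ p ∈ Finset.range (n + 1), h ^ p • f p x) k =
      fun x => ∑ q ∈ Finset.range ((k + 1) * n + 1), h ^ q • lieCoeff lieOp f k q x := by
  induction k with
  | zero => simp [lieIter, lieCoeff]
  | succ k ih =>
    funext x
    have hd : ∀ q, DifferentiableAt ℝ (lieCoeff lieOp f k q) x :=
      fun q => (contDiff_lieCoeff hf k q).differentiable (by simp) x
    rw [lieIter, ih, lieOp, fderiv_fun_sum fun q _ => (hd q).fun_const_smul _]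
    have hR : ∀ q, h ^ q • lieCoeff lieOp f (k + 1) q x =
        ∑ y ∈ Finset.HasAntidiagonal.antidiagonal q,
          h ^ (y.1 + y.2) • lieOp (lieCoeff lieOp f k y.1) (f y.2) x := by
      intro q
      simp only [lieCoeff, Finset.sum_apply, Finset.smul_sum]
      refine Finset.sum_congr rfl fun y hy => ?_
      rw [Finset.HasAntidiagonal.mem_antidiagonal.1 hy]
    simp only [hR]
    rw [sum_range_sum_antidiagonal (A := (k + 1) * n + 1) (B := n + 1)
      (F := fun a b => h ^ (a + b) • lieOp (lieCoeff lieOp f k a) (f b) x)]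
    · rw [sum_apply]
      refine Finset.sum_congr rfl fun a _ => ?_
      rw [fderiv_fun_const_smul (hd a), smul_apply, map_sum, Finset.smul_sum]
      refine Finset.sum_congr rfl fun b _ => ?_
      rw [map_smul, smul_smul, ← pow_add, lieOp]
    · apply le_of_eq
      ring
    · intro a b ha
      simp [lieOp, lieCoeff_eq_zero hn k (q := a) (by omega)]
    · intro a b hb
      simp [lieOp, hn b (by omega)]

/-- Treating `h` as an additional coordinate makes the Lipschitz constant and the bounds uniform in
small `h`. -/
theorem exists_local_bounds {F : ℝ × V → V} {G : ℝ × V → V} (x₀ : V)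
    (hF : ContDiff ℝ ∞ F) (hG : Continuous G) :
    ∃ r M : ℝ, ∃ K : NNReal, 0 < r ∧ 0 ≤ M ∧ ∀ h ∈ Icc 0 r,
      LipschitzOnWith K (fun x => F (h, x)) (Metric.closedBall x₀ r) ∧
      ∀ x ∈ Metric.closedBall x₀ r, ‖F (h, x)‖ ≤ M ∧ ‖G (h, x)‖ ≤ M := by
  obtain ⟨K, t, ht, hK⟩ :=
    (hF.of_le (by simp : (1 : WithTop ℕ∞) ≤ ∞)).contDiffAt (x := (0, x₀)) |>.exists_lipschitzOnWith
  set M := max (‖F (0, x₀)‖ + 1) (‖G (0, x₀)‖ + 1)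
  have h₁ : ∀ᶠ y in nhds ((0 : ℝ), x₀), ‖F y‖ < M :=
    hF.continuous.norm.continuousAt.eventually_lt_const
      ((lt_add_one _).trans_le (le_max_left _ _))
  have h₂ : ∀ᶠ y in nhds ((0 : ℝ), x₀), ‖G y‖ < M :=
    hG.norm.continuousAt.eventually_lt_const ((lt_add_one _).trans_le (le_max_right _ _))
  obtain ⟨r, hr, hsub⟩ := Metric.nhds_basis_closedBall.mem_iff.1
    (Filter.inter_mem (Filter.inter_mem h₁ h₂) ht)
  have hmem : ∀ h ∈ Icc 0 r, ∀ x ∈ Metric.closedBall x₀ r,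
      (h, x) ∈ Metric.closedBall ((0 : ℝ), x₀) r := by
    intro h hh x hx
    rw [← closedBall_prod_same]
    refine ⟨?_, hx⟩
    rw [Metric.mem_closedBall, Real.dist_0_eq_abs, abs_of_nonneg hh.1]
    exact hh.2
  refine ⟨r, M, K, hr, (by positivity : (0 : ℝ) ≤ ‖F (0, x₀)‖ + 1).trans (le_max_left _ _),
    fun h hh => ⟨?_, fun x hx => ?_⟩⟩
  · intro x hx y hy
    have := hK (hsub (hmem h hh x hx)).2 (hsub (hmem h hh y hy)).2
    simpa [Prod.edist_eq] using this
  · have := (hsub (hmem h hh x hx)).1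
    exact ⟨this.1.le, this.2.le⟩

theorem exists_solution [CompleteSpace V] {g : V → V} {x₀ : V} {r M h : ℝ} {K : NNReal}
    (hr : 0 < r) (hM : 0 ≤ M) (hh : 0 ≤ h) (hMh : M * h ≤ r)
    (hK : LipschitzOnWith K g (Metric.closedBall x₀ r))
    (hg : ∀ x ∈ Metric.closedBall x₀ r, ‖g x‖ ≤ M) :
    ∃ γ : ℝ → V, γ 0 = x₀ ∧
      ∀ t ∈ Icc 0 h, HasDerivWithinAt γ (g (γ t)) (Icc 0 h) t := by
  have : IsPicardLindelof (fun _ => g) (⟨0, left_mem_Icc.2 hh⟩ : Icc 0 h) x₀ ⟨r, hr.le⟩ 0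
      ⟨M, hM⟩ K :=
    { lipschitzOnWith := fun _ _ => hK
      continuousOn := fun _ _ => continuousOn_const
      norm_le := fun _ _ => hg
      mul_max_le := by
        change M * max (h - 0) (0 - 0) ≤ r - 0
        rwa [sub_zero, sub_zero, sub_zero, max_eq_left hh] }
  exact this.exists_eq_forall_mem_Icc_hasDerivWithinAt₀

theorem solution_mem_closedBall {g : V → V} {x₀ : V} {r M h : ℝ} {γ : ℝ → V}
    (hM : 0 ≤ M) (hMh : (M + 1) * h ≤ r) (hg : ∀ x ∈ Metric.closedBall x₀ r, ‖g x‖ ≤ M)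
    (h₀ : γ 0 = x₀) (hγ : ∀ t ∈ Icc 0 h, HasDerivWithinAt γ (g (γ t)) (Icc 0 h) t) :
    ∀ t ∈ Icc 0 h, γ t ∈ Metric.closedBall x₀ r := by
  have hball : ∀ t ∈ Icc 0 h, ‖γ t - x₀‖ ≤ (M + 1) * t → γ t ∈ Metric.closedBall x₀ r := by
    intro t ht hle
    rw [mem_closedBall_iff_norm]
    exact hle.trans ((mul_le_mul_of_nonneg_left ht.2 (by linarith)).trans hMh)
  intro t ht
  refine hball t ht ?_
  -- The bound on `g` holds only in the ball, so a barrier of slope `M + 1` is used: where the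
  -- distance meets it, the point is still in the ball and the speed is at most `M`, strictly less
  -- than the slope.
  refine image_norm_le_of_norm_deriv_right_lt_deriv_boundary (f := fun t => γ t - x₀)
    (fun t ht => ((hγ t ht).sub_const x₀).continuousWithinAt)
    (fun t ht => ((hγ t (Ico_subset_Icc_self ht)).sub_const x₀).mono_of_mem_nhdsWithin
      (Icc_mem_nhdsGE_of_mem ht)) (by simp [h₀])
    (fun t => ((hasDerivAt_id t).const_mul (M + 1))) (fun s hs heq => ?_) ht
  rw [mul_one]
  exact (hg _ (hball s (Ico_subset_Icc_self hs) heq.le)).trans_lt (lt_add_one M)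

theorem hasDerivWithinAt_lieIter {g : V → V} (hg : ContDiff ℝ ∞ g) {γ : ℝ → V} {s : Set ℝ} {t : ℝ}
    (hγ : HasDerivWithinAt γ (g (γ t)) s t) (k : ℕ) :
    HasDerivWithinAt (fun t => lieIter g k (γ t)) (lieIter g (k + 1) (γ t)) s t := by
  have : ContDiff ℝ ∞ (lieIter g k) := by
    induction k with
    | zero => exact hg
    | succ k ih => exact contDiff_lieOp ih hg
  exact ((this.differentiable (by simp) (γ t)).hasFDerivAt).comp_hasDerivWithinAt t hγ

theorem norm_sum_lieIter_sub_flowCoeff_le {f : ℕ → V → V} (hf : ∀ p, ContDiff ℝ ∞ (f p)) {n : ℕ}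
    (hn : ∀ p, n < p → f p = 0) (x : V) :
    ∃ C : ℝ, 0 ≤ C ∧ ∀ h ∈ Icc (0 : ℝ) 1,
      ‖∑ k ∈ Finset.range (n + 1), (h ^ (k + 1) / ((k + 1).factorial : ℝ)) •
          lieIter (fun x => ∑ p ∈ Finset.range (n + 1), h ^ p • f p x) k x -
        ∑ m ∈ Finset.range (n + 1), h ^ (m + 1) • flowCoeff lieOp f m x‖ ≤ C * h ^ (n + 2) := by
  -- Cutting off at `k ≤ n` keeps the double sum finite. Grouped by `k + q`, the groups up to `n`
  -- are the flow coefficients, and the rest carry powers at least `h^(n+2)`.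
  set c : ℕ → ℕ → V := fun k q =>
    if k < n + 1 then (((k + 1).factorial : ℝ)⁻¹) • lieCoeff lieOp f k q x else 0 with hc
  set R := (n + 1) * n + 1 with hR
  refine ⟨∑ i ∈ Finset.range R,
    ‖∑ y ∈ Finset.HasAntidiagonal.antidiagonal (n + 1 + i), c y.1 y.2‖,
    Finset.sum_nonneg fun _ _ => norm_nonneg _, fun h hh => ?_⟩
  have h₁ : ∑ k ∈ Finset.range (n + 1), (h ^ (k + 1) / ((k + 1).factorial : ℝ)) •
      lieIter (fun x => ∑ p ∈ Finset.range (n + 1), h ^ p • f p x) k x =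
      ∑ k ∈ Finset.range (n + 1), ∑ q ∈ Finset.range R, h ^ (k + q + 1) • c k q := by
    refine Finset.sum_congr rfl fun k hk => ?_
    rw [Finset.mem_range] at hk
    rw [lieIter_eq_sum hf hn, Finset.smul_sum]
    refine (Finset.sum_congr rfl fun q _ => ?_).trans (Finset.sum_subset ?_ ?_)
    · rw [hc]
      simp only [hk, if_true]
      rw [smul_smul, smul_smul]
      congr 1
      ring
    · refine Finset.range_mono ?_
      have := Nat.mul_le_mul_right n (show k + 1 ≤ n + 1 by omega)
      omega
    · intro q _ hq
      rw [Finset.mem_range, not_lt] at hq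
      simp [hc, lieCoeff_eq_zero hn k (q := q) (by omega)]
  have h₂ : ∀ m, ∑ y ∈ Finset.HasAntidiagonal.antidiagonal m, h ^ (y.1 + y.2 + 1) • c y.1 y.2 =
      h ^ (m + 1) • ∑ y ∈ Finset.HasAntidiagonal.antidiagonal m, c y.1 y.2 := by
    intro m
    rw [Finset.smul_sum]
    refine Finset.sum_congr rfl fun y hy => ?_
    rw [Finset.HasAntidiagonal.mem_antidiagonal.1 hy]
  have h₃ : ∀ m ∈ Finset.range (n + 1),
      h ^ (m + 1) • ∑ y ∈ Finset.HasAntidiagonal.antidiagonal m, c y.1 y.2 =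
        h ^ (m + 1) • flowCoeff lieOp f m x := by
    intro m hm
    rw [Finset.mem_range] at hm
    congr 1
    rw [flowCoeff, Finset.sum_apply]
    refine Finset.sum_congr rfl fun y hy => ?_
    rw [Finset.HasAntidiagonal.mem_antidiagonal] at hy
    rw [hc]
    simp only [show y.1 < n + 1 by omega, if_true, Pi.smul_apply]
  rw [h₁, ← sum_range_sum_antidiagonal (Q := n + 1 + R) (by omega)]
  · simp only [h₂]
    rw [Finset.sum_range_add, Finset.sum_congr rfl h₃, add_sub_cancel_left, Finset.sum_mul]
    refine norm_sum_le_of_le _ fun i _ => ?_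
    rw [norm_smul, mul_comm]
    refine mul_le_mul_of_nonneg_left ?_ (norm_nonneg _)
    rw [Real.norm_of_nonneg (pow_nonneg hh.1 _)]
    exact pow_le_pow_of_le_one hh.1 hh.2 (by omega)
  · intro a b ha
    simp [hc, show ¬ a ≤ n by omega]
  · intro a b hb
    by_cases ha : a < n + 1
    · have := Nat.mul_le_mul_right n (show a + 1 ≤ n + 1 by omega)
      simp [hc, lieCoeff_eq_zero hn a (q := b) (by omega)]
    · simp [hc, show ¬ a ≤ n by omega]

/-- The time-`h` flow of `∑_{p ≤ n} h^p f_p` exists for small `h`, and has the expansion given by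
`flowCoeff` up to an error `O(h^(n+2))`. -/
theorem exists_flow_expansion [CompleteSpace V] {f : ℕ → V → V} (hf : ∀ p, ContDiff ℝ ∞ (f p))
    (n : ℕ) (x₀ : V) :
    ∃ C h₀ : ℝ, 0 < h₀ ∧ ∀ h : ℝ, 0 < h → h < h₀ →
      (∃ γ : ℝ → V, γ 0 = x₀ ∧ ∀ t ∈ Icc 0 h,
        HasDerivWithinAt γ (∑ p ∈ Finset.range (n + 1), h ^ p • f p (γ t)) (Icc 0 h) t) ∧
      ∀ γ : ℝ → V, γ 0 = x₀ → (∀ t ∈ Icc 0 h,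
        HasDerivWithinAt γ (∑ p ∈ Finset.range (n + 1), h ^ p • f p (γ t)) (Icc 0 h) t) →
      ‖γ h - (x₀ + ∑ m ∈ Finset.range (n + 1), h ^ (m + 1) • flowCoeff lieOp f m x₀)‖ ≤
        C * h ^ (n + 2) := by
  -- Coefficients beyond `n` enter neither the truncated field nor the flow coefficients up to `n`;
  -- setting them to zero makes each iterated Lie derivative polynomial in `h`.
  wlog hn : ∀ p, n < p → f p = 0 generalizing f
  · have hf' : ∀ p, ContDiff ℝ ∞ (if p < n + 1 then f p else 0) := by
      intro p
      split_ifs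
      exacts [hf p, contDiff_const]
    have key := this hf' fun p hp => if_neg (by omega)
    have e₁ : ∀ (h : ℝ) (x : V), ∑ p ∈ Finset.range (n + 1),
        h ^ p • (if p < n + 1 then f p else 0) x = ∑ p ∈ Finset.range (n + 1), h ^ p • f p x :=
      fun h x => Finset.sum_congr rfl fun p hp => by rw [if_pos (Finset.mem_range.1 hp)]
    have e₂ : ∀ h : ℝ, ∑ m ∈ Finset.range (n + 1), h ^ (m + 1) •
        flowCoeff lieOp (fun p => if p < n + 1 then f p else 0) m x₀ =
        ∑ m ∈ Finset.range (n + 1), h ^ (m + 1) • flowCoeff lieOp f m x₀ := by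
      intro h
      refine Finset.sum_congr rfl fun m hm => ?_
      rw [Finset.mem_range] at hm
      rw [flowCoeff, flowCoeff, Finset.sum_apply, Finset.sum_apply]
      congr 1
      refine Finset.sum_congr rfl fun y hy => ?_
      rw [Finset.HasAntidiagonal.mem_antidiagonal] at hy
      rw [lieCoeff_congr y.1 fun p hp => if_pos (show p < n + 1 by omega)]
    simpa only [e₁, e₂] using key
  set g : ℝ → V → V := fun h x => ∑ p ∈ Finset.range (n + 1), h ^ p • f p x with hg
  have hF : ContDiff ℝ ∞ (fun y : ℝ × V => g y.1 y.2) :=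
    ContDiff.sum fun p _ => (contDiff_fst.pow p).smul ((hf p).comp contDiff_snd)
  have hgh : ∀ h, ContDiff ℝ ∞ (g h) := fun h => hF.comp (contDiff_prodMk_right h)
  have hG : Continuous (fun y : ℝ × V => lieIter (g y.1) (n + 1) y.2) := by
    simp only [hg, lieIter_eq_sum hf hn]
    exact continuous_finsetSum _ fun q _ =>
      (continuous_fst.pow q).smul ((contDiff_lieCoeff hf _ q).continuous.comp continuous_snd)
  obtain ⟨r, M, K, hr, hM, hbound⟩ := exists_local_bounds x₀ hF hG
  obtain ⟨C, -, hC⟩ := norm_sum_lieIter_sub_flowCoeff_le hf hn x₀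
  -- The two constants are the Taylor remainder and the regrouping error. The bounds on `h` give, in
  -- turn, the uniform estimates, `h ≤ 1` for comparing powers, and confinement of solutions to the
  -- ball.
  refine ⟨M / ((n + 2).factorial : ℝ) + C, min (min r 1) (r / (M + 1)), by positivity,
    fun h hh hlt => ?_⟩
  obtain ⟨⟨hlr, hl1⟩, hlM⟩ := (lt_min_iff.1 hlt).imp_left lt_min_iff.1
  obtain ⟨hLip, hb⟩ := hbound h ⟨hh.le, hlr.le⟩
  have hMh : (M + 1) * h ≤ r := by
    rw [lt_div_iff₀ (by positivity), mul_comm] at hlM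
    exact hlM.le
  refine ⟨exists_solution hr hM hh.le (by nlinarith) hLip fun x hx => (hb x hx).1,
    fun γ h0 hγ => ?_⟩
  have hball := solution_mem_closedBall (g := g h) hM hMh (fun x hx => (hb x hx).1) h0 hγ
  have hT := norm_sub_taylor_le (N := n + 2) (h := h) (K := M)
    (φ := fun k => Nat.casesOn k γ fun k t => lieIter (g h) k (γ t))
    (by
      intro k _ t ht
      cases k with
      | zero => exact hγ t ht
      | succ k => exact hasDerivWithinAt_lieIter (hgh h) (hγ t ht) k)
    (fun t ht => (hb _ (hball t ht)).2) h (right_mem_Icc.2 hh.le)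
  rw [Finset.sum_range_succ' _ (n + 1)] at hT
  simp only [h0, pow_zero, Nat.factorial_zero, Nat.cast_one, div_one, one_smul] at hT
  change ‖γ h - (_ + γ 0)‖ ≤ _ at hT
  rw [h0] at hT
  have hS := hC h ⟨hh.le, hl1.le⟩
  refine (le_of_eq ?_).trans ((norm_add_le_of_le hT hS).trans (le_of_eq ?_))
  · congr 1
    simp only [hg]
    abel
  · ring

/-- Letting `h → 0⁺` kills the constant term; dividing by `h` then lowers `N` by one. -/
theorem eq_zero_of_norm_sum_pow_smul_le {N : ℕ} {v : ℕ → V} {C h₀ : ℝ} (h₀_pos : 0 < h₀)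
    (hv : ∀ h : ℝ, 0 < h → h < h₀ → ‖∑ m ∈ Finset.range N, h ^ m • v m‖ ≤ C * h ^ N) :
    ∀ m < N, v m = 0 := by
  induction N generalizing v with
  | zero => intro m hm; omega
  | succ N ih =>
    have hv0 : v 0 = 0 := by
      have h₁ : Filter.Tendsto (fun h : ℝ => ‖∑ m ∈ Finset.range (N + 1), h ^ m • v m‖)
          (nhdsWithin 0 (Ioi 0)) (nhds ‖v 0‖) := by
        have : Continuous (fun h : ℝ => ‖∑ m ∈ Finset.range (N + 1), h ^ m • v m‖) := by fun_prop
        have h := this.tendsto 0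
        rw [Finset.sum_range_succ'] at h
        simp only [ne_eq, Nat.add_eq_zero_iff, one_ne_zero, and_false, not_false_eq_true,
          zero_pow, zero_smul, Finset.sum_const_zero, pow_zero, one_smul, zero_add] at h
        exact h.mono_left nhdsWithin_le_nhds
      have h₂ : Filter.Tendsto (fun h : ℝ => C * h ^ (N + 1)) (nhdsWithin 0 (Ioi 0)) (nhds 0) := by
        have : Continuous (fun h : ℝ => C * h ^ (N + 1)) := by fun_prop
        have h := this.tendsto 0
        simp only [ne_eq, Nat.add_eq_zero_iff, one_ne_zero, and_false, not_false_eq_true,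
          zero_pow, mul_zero] at h
        exact h.mono_left nhdsWithin_le_nhds
      have h₃ : ‖v 0‖ ≤ 0 := by
        refine le_of_tendsto_of_tendsto h₁ h₂ ?_
        filter_upwards [Ioo_mem_nhdsGT h₀_pos] with h hh
        exact hv h hh.1 hh.2
      exact norm_le_zero_iff.1 h₃
    have hs := ih (v := fun m => v (m + 1)) fun h hh hlt => by
      have := hv h hh hlt
      rw [Finset.sum_range_succ', hv0, smul_zero, add_zero] at this
      simp only [pow_succ' h, mul_smul] at this
      rw [← Finset.smul_sum, norm_smul, Real.norm_of_nonneg hh.le, mul_left_comm] at this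
      exact le_of_mul_le_mul_left this hh
    intro m hm
    cases m with
    | zero => exact hv0
    | succ m => exact hs m (by omega)

end FlowExpansion

/-! ### The modified field as the unique solution of the flow equations. -/

section Characterization

variable {D : ℕ} {E : Param D → ℝ}

theorem sum_descent_flowCoeff (h : ℝ) (n : ℕ) (θ : Param D) :
    ∑ m ∈ Finset.range (n + 1), h ^ (m + 1) • (if m = 0 then -gradient E else 0) θ =
      -(h • gradient E θ) := by
  rw [Finset.sum_range_succ']
  simp

theorem tracksGradientDescent_of_flowCoeff_eq {f : ℕ → Param D → Param D}
    (hf : ∀ p, ContDiff ℝ ∞ (f p))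
    (hc : ∀ n, flowCoeff lieOp f n = if n = 0 then -gradient E else 0) (n : ℕ) :
    TracksGradientDescent E f n := by
  intro θ
  obtain ⟨C, h₀, hpos, key⟩ := exists_flow_expansion hf n θ
  refine ⟨C, h₀, hpos, fun h hh hlt => ?_⟩
  obtain ⟨⟨γ, h0, hγ⟩, hexp⟩ := key h hh hlt
  refine ⟨γ, h0, hγ, ?_⟩
  have := hexp γ h0 hγ
  simp only [hc] at this
  rwa [sum_descent_flowCoeff, ← sub_eq_add_neg] at this

/-- The expansion holds for every solution, hence for the one supplied by tracking. Comparing the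
two estimates bounds a polynomial in `h` by a power above its degree, so its coefficients vanish. -/
theorem flowCoeff_eq_of_tracksGradientDescent {f : ℕ → Param D → Param D}
    (hf : ∀ p, ContDiff ℝ ∞ (f p)) (ht : ∀ n, TracksGradientDescent E f n) (n : ℕ) :
    flowCoeff lieOp f n = if n = 0 then -gradient E else 0 := by
  funext θ
  obtain ⟨C, h₀, hpos, key⟩ := exists_flow_expansion hf n θ
  obtain ⟨C', h₀', hpos', key'⟩ := ht n θ
  refine sub_eq_zero.1 (eq_zero_of_norm_sum_pow_smul_le (N := n + 1) (C := C + C')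
    (h₀ := min h₀ h₀')
    (v := fun m => flowCoeff lieOp f m θ - (if m = 0 then -gradient E else 0 : Param D → Param D) θ)
    (lt_min hpos hpos') (fun h hh hlt => ?_) n n.lt_succ_self)
  rw [lt_min_iff] at hlt
  obtain ⟨γ, h0, hγ, hle'⟩ := key' h hh hlt.2
  have hle := (key h hh hlt.1).2 γ h0 hγ
  have hsum : h • ∑ m ∈ Finset.range (n + 1), h ^ m •
      (flowCoeff lieOp f m θ - (if m = 0 then -gradient E else 0 : Param D → Param D) θ) =
      (γ h - (θ - h • gradient E θ)) -
        (γ h - (θ + ∑ m ∈ Finset.range (n + 1), h ^ (m + 1) • flowCoeff lieOp f m θ)) := by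
    have h₁ := sum_descent_flowCoeff (E := E) h n θ
    rw [Finset.smul_sum]
    simp only [smul_smul, ← pow_succ', smul_sub, Finset.sum_sub_distrib, h₁]
    abel
  have := norm_sub_le_of_le hle' hle
  rw [← hsum, norm_smul, Real.norm_of_nonneg hh.le] at this
  refine le_of_mul_le_mul_left (this.trans (le_of_eq ?_)) hh
  ring

theorem isBEAModifiedField_iff (hE : ContDiff ℝ ∞ E) {f : ℕ → Param D → Param D} :
    IsBEAModifiedField E f ↔ f = fun p => fieldEval E (modifiedField D p) := by
  constructor
  · rintro ⟨hf, ht⟩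
    refine eq_of_flowCoeff_eq (op := lieOp) fun n => ?_
    rw [flowCoeff_eq_of_tracksGradientDescent hf ht, flowCoeff_fieldEval_modifiedField hE]
  · rintro rfl
    have hf : ∀ p, ContDiff ℝ ∞ (fieldEval E (modifiedField D p)) :=
      fun p => contDiff_fieldEval hE _
    exact ⟨hf, tracksGradientDescent_of_flowCoeff_eq hf (flowCoeff_fieldEval_modifiedField hE)⟩

end Characterization

/-! ### Spectral form of the powers of the Hessian. -/

section Eigenbasis

variable {D : ℕ} {E : Param D → ℝ} {θ : Param D}

theorem exists_antitone_isHessianEigenbasis (hE : ContDiff ℝ ∞ E) (θ : Param D) :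
    ∃ (u : OrthonormalBasis (Fin D) ℝ (Param D)) (ev : Fin D → ℝ),
      Antitone ev ∧ IsHessianEigenbasis E θ u ev := by
  have hH : (hessian E θ).IsHermitian := by
    rw [Matrix.IsHermitian, Matrix.conjTranspose_eq_transpose_of_trivial]
    exact (hessian_isSymm hE θ).eq
  -- Sorting the negated eigenvalues in increasing order puts the eigenvalues in decreasing order.
  refine ⟨hH.eigenvectorBasis.reindex (Tuple.sort (fun i => -hH.eigenvalues i)).symm,
    fun i => hH.eigenvalues (Tuple.sort (fun i => -hH.eigenvalues i) i), ?_, fun i => ?_⟩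
  · have := Tuple.monotone_sort fun i => -hH.eigenvalues i
    exact fun i j hij => neg_le_neg_iff.1 (this hij)
  · rw [OrthonormalBasis.reindex_apply, Equiv.symm_symm]
    exact hH.mulVec_eigenvectorBasis _

theorem hessian_pow_mulVec_eigenvector {u : OrthonormalBasis (Fin D) ℝ (Param D)} {ev : Fin D → ℝ}
    (hu : IsHessianEigenbasis E θ u ev) (p : ℕ) (i : Fin D) :
    hessian E θ ^ p *ᵥ (u i).ofLp = ev i ^ p • (u i).ofLp := by
  induction p with
  | zero => simp
  | succ p ih =>
    rw [pow_succ, ← Matrix.mulVec_mulVec, hu i, Matrix.mulVec_smul, ih, smul_smul, ← pow_succ']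

theorem hessian_pow_mulVec {u : OrthonormalBasis (Fin D) ℝ (Param D)} {ev : Fin D → ℝ}
    (hu : IsHessianEigenbasis E θ u ev) (p : ℕ) (w : Param D) :
    hessian E θ ^ p *ᵥ w.ofLp = ∑ i, ev i ^ p • ((w.ofLp ⬝ᵥ (u i).ofLp) • (u i).ofLp) := by
  have hw : w.ofLp = ∑ i, (w.ofLp ⬝ᵥ (u i).ofLp) • (u i).ofLp := by
    conv_lhs => rw [← u.sum_repr' w]
    rw [WithLp.ofLp_sum]
    refine Finset.sum_congr rfl fun i _ => ?_
    rw [WithLp.ofLp_smul, EuclideanSpace.inner_eq_star_dotProduct, star_trivial]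
  conv_lhs => rw [hw]
  rw [Matrix.mulVec_sum]
  refine Finset.sum_congr rfl fun i _ => ?_
  rw [Matrix.mulVec_smul, hessian_pow_mulVec_eigenvector hu, smul_comm]

theorem sum_vecMulVec_mulVec (u : OrthonormalBasis (Fin D) ℝ (Param D)) (c : Fin D → ℝ)
    (w : Param D) :
    (∑ i, c i • Matrix.vecMulVec (u i).ofLp (u i).ofLp) *ᵥ w.ofLp =
      ∑ i, c i • ((w.ofLp ⬝ᵥ (u i).ofLp) • (u i).ofLp) := by
  rw [Matrix.sum_mulVec]
  refine Finset.sum_congr rfl fun i _ => ?_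
  rw [Matrix.smul_mulVec, Matrix.vecMulVec_mulVec, op_smul_eq_smul, dotProduct_comm]

end Eigenbasis

theorem mainTheorem2 (D : ℕ) :
    ∃ P : ℕ → Fin D → DiffPoly D, (∀ p k, (P p k).IsNonPrincipal) ∧
      ∀ E : Param D → ℝ, ContDiff ℝ ∞ E →
        (∃! f : ℕ → Param D → Param D, IsBEAModifiedField E f) ∧
        ∀ f : ℕ → Param D → Param D, IsBEAModifiedField E f → ∀ θ : Param D,
          formalSeries (fun p => (f p θ).ofLp) =
              formalSeries (fun p =>
                (-1 / ((p : ℝ) + 1)) • ((hessian E θ) ^ p *ᵥ (gradient E θ).ofLp)) +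
              formalSeries (fun p k => (P p k).evalAt E θ) ∧
          (∃ (u : OrthonormalBasis (Fin D) ℝ (Param D)) (ev : Fin D → ℝ),
            Antitone ev ∧ IsHessianEigenbasis E θ u ev) ∧
          ∀ (u : OrthonormalBasis (Fin D) ℝ (Param D)) (ev : Fin D → ℝ),
            IsHessianEigenbasis E θ u ev →
            formalSeries (fun p => (f p θ).ofLp) =
                formalSeries (fun p =>
                  (-1 / ((p : ℝ) + 1)) •
                    ((∑ i, ev i ^ p • Matrix.vecMulVec (u i).ofLp (u i).ofLp) *ᵥ
                      (gradient E θ).ofLp)) +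
                formalSeries (fun p k => (P p k).evalAt E θ) ∧
            formalSeries (fun p => (f p θ).ofLp) =
                (∑ i, (PowerSeries.mk fun p => (-1 / ((p : ℝ) + 1)) * ev i ^ p) •
                  constSeries (((gradient E θ).ofLp ⬝ᵥ (u i).ofLp) • (u i).ofLp)) +
                formalSeries (fun p k => (P p k).evalAt E θ) := by
  -- The correction is the whole discrepancy between the universal field and its principal part, so
  -- it does not depend on `E`.
  refine ⟨fun p => modifiedField D p - principalPart D p, fun p k => mem_nonPrincipalIdeal.1
    (mem_nonPrincipalVectors.1 (modifiedField_sub_principalPart_mem p) k), fun E hE => ⟨?_, ?_⟩⟩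
  · simp only [isBEAModifiedField_iff hE]
    exact existsUnique_eq
  intro f hf θ
  rw [isBEAModifiedField_iff hE] at hf
  have key : formalSeries (fun p => (f p θ).ofLp) =
      formalSeries (fun p =>
        (-1 / ((p : ℝ) + 1)) • ((hessian E θ) ^ p *ᵥ (gradient E θ).ofLp)) +
      formalSeries (fun p k => ((modifiedField D p - principalPart D p) k).evalAt E θ) := by
    funext k
    ext p
    simp only [formalSeries, Pi.add_apply, map_add, PowerSeries.coeff_mk, hf]
    rw [← fieldEval_principalPart hE, fieldEval_apply, fieldEval_apply, Pi.sub_apply]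
    simp [DiffPoly.evalAt]
  refine ⟨key, exists_antitone_isHessianEigenbasis hE θ, fun u ev hu => ⟨?_, ?_⟩⟩
  · rw [key]
    simp only [hessian_pow_mulVec hu, sum_vecMulVec_mulVec]
  · rw [key]
    congr 1
    funext k
    ext p
    simp only [formalSeries, constSeries, hessian_pow_mulVec hu, PowerSeries.coeff_mk,
      Finset.sum_apply, Pi.smul_apply, smul_eq_mul, map_sum, Finset.mul_sum,
      PowerSeries.coeff_mul_C, mul_assoc]
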